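/- **Setting.** A function $\mu:\mathbb N\to\mathbb R$ is *negligible* if $n^k\mu(n)\to 0$ for every $k$. Let $L=(L_{yes},L_{no})$ be a promise problem (two disjoint sets of bit strings) with a verifier $V_L$ of negligible error $\mu$: for each instance $x\in\{0,1\}^n$, $V_L(x,\cdot)$ is a quantum operation from $m=m(n)$ qubits to one qubit, which is then measured; if $x\in L_{yes}$, some witness state is accepted with probability at least $1-\mu(n)$, and if $x\in L_{no}$, every state is accepted with probability at most $\mu(n)$. Let $F=F_n$ be the functionality that on classical input $z=(x,u,v)\in\{0,1\}^{n}\times\{0,1\}^m\times\{0,1\}^m$ and an $m$-qubit state $\tilde w$ outputs $V_L\big(x,(X^{u_1}Z^{v_1}\otimes\cdots\otimes X^{u_m}Z^{v_m})(\tilde w)\big)$. Let $\mathsf{Com}(1^\lambda,\cdot\,;\cdot)$ be a perfectly binding non-interactive commitment scheme: $\mathsf{Com}(1^\lambda,y_1;s_1)=\mathsf{Com}(1^\lambda,y_2;s_2)$ implies $y_1=y_2$ (for messages of the same length; the lengths of the randomness and of the commitment are determined by $\lambda$ and the message length). For each $n$, let a decomposable quantum randomized encoding of $F_n$ be given. That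 is, for each value $r$ of a random string of fixed length there are unitaries $\hat F_{\mathsf{off}},\hat F_1,\dots,\hat F_m$ on disjoint sets of qubits, where $\hat F_i$ acts on the $i$-th input qubit, on some halves of EPR pairs and on zero ancillas, and $\hat F_{\mathsf{off}}$ acts on the remaining halves of EPR pairs and on zero ancillas; a fixed subset of the resulting qubits is the output $\hat F_0$, and all other qubits end up as zero qubits. Moreover each classical input bit $i\in[n+2m]$ and value $b\in\{0,1\}$ has a classical label $\mathsf{lab}_{i,b}(r)$. Finally there is a decoder $\mathsf{Dec}$ that is perfectly correct: for all $r$ and $z$ and every state of the $m$ input qubits, possibly entangled with side information, $\mathsf{Dec}$ maps $\big(\hat F_0,(\mathsf{lab}_{i,z_i}(r))_i\big)$ to the output of $F$ on $z$ and this state, jointly with the side information. Let $U_r$ be the unitary that creates the EPR pairs from zero qubits, applies $\hat F_{\mathsf{off}},\hat F_1,\dots,\hat F_m$ to the $m$ input qubits, the EPR pairs and the ancillas, and writes all labels $(\mathsf{lab}_{i,b}(r))_{i,b}$ into zero qubits. (Efficiency, privacy of the encoding and hiding of the commitments are not needed here and are not assumed.) **Verifier.** The instance length $n$ is known and $\lambda=n$.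 The verifier $V$ receives a first message consisting of a quantum register $\hat F_0$ and commitments $c_0,(c_{i,b})_{i\in[n+2m],\,b\in\{0,1\}}$, sends a uniformly random bit $b$, and receives a reply and the instance $x\in\{0,1\}^n$. * If $b=0$, the reply is $(r,s_0)$ and $(\mathsf{lab}_{i,b'},s_{i,b'})_{i,b'}$. $V$ rejects unless $c_0=\mathsf{Com}(1^\lambda,r;s_0)$ and $c_{i,b'}=\mathsf{Com}(1^\lambda,\mathsf{lab}_{i,b'};s_{i,b'})$ for all $i,b'$. It then applies $U_r^{-1}$ to $\hat F_0$, the labels $(\mathsf{lab}_{i,b'})_{i,b'}$ and zero qubits, and accepts iff all qubits other than the $m$ input qubits are measured to be zero. * If $b=1$, the reply is $z$ and $(\mathsf{lab}_i,s_i)_{i\in[n+2m]}$. $V$ rejects unless $z=(x,u,v)$ for some $u,v$ and $c_{i,z_i}=\mathsf{Com}(1^\lambda,\mathsf{lab}_i;s_i)$ for all $i$. It then applies $\mathsf{Dec}$ to $(\hat F_0,(\mathsf{lab}_i)_i)$, measures the resulting qubit, and accepts iff the outcome is $1$. **Adaptive prover.** A computationally unbounded adaptive prover $P^*$ prepares an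 arbitrary joint state of a finite-dimensional private register and the first message and, after seeing $b$, performs an arbitrary measurement on its private register, whose outcome is the reply together with the instance $x$. **Lemma (statistical adaptive soundness).** There is a negligible function $\mu'$ such that for every $n$ and every adaptive prover $P^*$ for instance length $n$, $$\Pr\big[V\text{ accepts and }x\in L_{no}\big]\le \tfrac12+\mu'(n),$$ where $x$ is the instance output by $P^*$. -/

import Mathlib

namespace QZK

open scoped Kronecker Matrix ComplexOrder

noncomputable section

/-- Bit strings of length `n`. A register of `n` qubits has the computational basis `Bits n`; more
generally, a register with computational basis `α` is the Hilbert space `α → ℂ`, and its operators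
are the matrices `Matrix α α ℂ`. -/
abbrev Bits (n : ℕ) : Type := Fin n → Bool

/-! ### States, quantum operations, measurements -/

/-- Density matrices. -/
structure IsDensity {α : Type} [Fintype α] (ρ : Matrix α α ℂ) : Prop where
  posSemidef : ρ.PosSemidef
  trace_eq_one : ρ.trace = 1

/-- A quantum operation (completely positive trace-preserving map) from a register with basis `α` to
a register with basis `β`, given by Kraus operators. -/
structure QOp (α β : Type) [Fintype α] [DecidableEq α] [Fintype β] where
  rank : ℕ
  kraus : Fin rank → Matrix β α ℂ
  complete : ∑ k, (kraus k)ᴴ * kraus k = 1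

section QOp

variable {α β : Type} [Fintype α] [DecidableEq α] [Fintype β]

/-- The action of a quantum operation on a state of its input register. -/
def QOp.apply (Φ : QOp α β) (ρ : Matrix α α ℂ) : Matrix β β ℂ :=
  ∑ k, Φ.kraus k * ρ * (Φ.kraus k)ᴴ

/-- The action of a quantum operation on the first part of a joint state with a side register. -/
def QOp.applySide (Φ : QOp α β) {σ : Type} [Fintype σ] [DecidableEq σ]
    (ρ : Matrix (α × σ) (α × σ) ℂ) : Matrix (β × σ) (β × σ) ℂ :=
  ∑ k, (Φ.kraus k ⊗ₖ (1 : Matrix σ σ ℂ)) * ρ * (Φ.kraus k ⊗ₖ (1 : Matrix σ σ ℂ))ᴴ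

/-- Apply the operation, whose output is a single qubit, and measure that qubit in the computational
basis: the probability of outcome `1`. (For a subnormalized state: the joint probability.) -/
def QOp.acceptProb (Φ : QOp α Bool) (ρ : Matrix α α ℂ) : ℝ :=
  (Φ.apply ρ true true).re

/-- First apply a unitary (or an isometry) to the input, then the operation `Φ`. -/
def QOp.precomp {γ : Type} [Fintype γ] [DecidableEq γ] (Φ : QOp α β) (W : Matrix α γ ℂ)
    (hW : Wᴴ * W = 1) : QOp γ β where
  rank := Φ.rank
  kraus k := Φ.kraus k * W
  complete := by
    have h : ∀ k, (Φ.kraus k * W)ᴴ * (Φ.kraus k * W) = Wᴴ * ((Φ.kraus k)ᴴ * Φ.kraus k) * W := by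
      intro k
      simp only [Matrix.conjTranspose_mul, Matrix.mul_assoc]
    simp only [h]
    rw [← Matrix.sum_mul, ← Matrix.mul_sum, Φ.complete, Matrix.mul_one, hW]

end QOp

/-- A measurement with outcomes in `O` on a register with basis `α` (a POVM). -/
structure POVM (α O : Type) [Fintype α] [DecidableEq α] [Fintype O] where
  effect : O → Matrix α α ℂ
  posSemidef : ∀ o, (effect o).PosSemidef
  sum_eq_one : ∑ o, effect o = 1

/-- The first part of the joint state `ρ` is measured and discarded. This is the subnormalized state
of the second part for a measurement outcome with effect `E`; its trace is the probability of that
outcome. -/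
def residual {α β : Type} [Fintype α] (E : Matrix α α ℂ) (ρ : Matrix (α × β) (α × β) ℂ) :
    Matrix β β ℂ :=
  Matrix.of fun b b' => ∑ i, ∑ j, E i j * ρ (j, b) (i, b')

/-- The second part of the joint state `σ` is measured in the computational basis, with outcome `c`.
This is the subnormalized state of the first part. -/
def readSecond {α β : Type} (σ : Matrix (α × β) (α × β) ℂ) (c : β) : Matrix α α ℂ :=
  Matrix.of fun a a' => σ (a, c) (a', c)

/-! ### Tensor products and gates -/

/-- The tensor product of a family of operators. -/
def tensor {ι : Type} [Fintype ι] {w : ι → Type} (A : ∀ p, Matrix (w p) (w p) ℂ) :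
    Matrix (∀ p, w p) (∀ p, w p) ℂ :=
  Matrix.of fun x y => ∏ p, A p (x p) (y p)

theorem tensor_conjTranspose_mul_self {ι : Type} [Fintype ι] [DecidableEq ι] {w : ι → Type}
    [∀ p, Fintype (w p)] [∀ p, DecidableEq (w p)] (A : ∀ p, Matrix (w p) (w p) ℂ)
    (hA : ∀ p, (A p)ᴴ * A p = 1) : (tensor A)ᴴ * tensor A = 1 := by
  ext x y
  have h : ∀ p, ∑ z, star (A p z (x p)) * A p z (y p) = if x p = y p then 1 else 0 := by
    intro p
    have := congrFun (congrFun (hA p) (x p)) (y p)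
    simpa [Matrix.mul_apply, Matrix.one_apply] using this
  simp only [Matrix.mul_apply, Matrix.conjTranspose_apply, tensor, Matrix.of_apply, star_prod,
    ← Finset.prod_mul_distrib]
  rw [← Fintype.prod_sum (fun p z => star (A p z (x p)) * A p z (y p))]
  simp only [h, Matrix.one_apply, Finset.prod_ite_zero, Finset.prod_const_one, funext_iff,
    Finset.mem_univ, true_imp_iff]

def pauliX : Matrix Bool Bool ℂ := Matrix.of fun a b => if a = !b then 1 else 0

def pauliZ : Matrix Bool Bool ℂ := Matrix.of fun a b => if a = b then (if b then -1 else 1) else 0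

/-- The quantum one-time pad `X^{u₁} Z^{v₁} ⊗ ⋯ ⊗ X^{uₘ} Z^{vₘ}`. -/
def pad {m : ℕ} (u v : Bits m) : Matrix (Bits m) (Bits m) ℂ :=
  tensor fun i => (if u i then pauliX else 1) * (if v i then pauliZ else 1)

theorem pad_isometry {m : ℕ} (u v : Bits m) : (pad u v)ᴴ * pad u v = 1 := by
  apply tensor_conjTranspose_mul_self
  intro i
  cases u i <;> cases v i <;> ext a b <;> cases a <;> cases b <;>
    simp [Matrix.mul_apply, pauliX, pauliZ]

def hadamard : Matrix Bool Bool ℂ :=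
  Matrix.of fun a b => (if a && b then -1 else 1) / ((Real.sqrt 2 : ℝ) : ℂ)

/-- The controlled-not gate; the first qubit is the control. -/
def cnot : Matrix (Bool × Bool) (Bool × Bool) ℂ :=
  Matrix.of fun a b => if a = (b.1, xor b.1 b.2) then 1 else 0

/-- The circuit that turns two zero qubits into an EPR pair. -/
def eprGate : Matrix (Bool × Bool) (Bool × Bool) ℂ :=
  cnot * (hadamard ⊗ₖ (1 : Matrix Bool Bool ℂ))

theorem eprGate_isometry : eprGateᴴ * eprGate = 1 := by
  have h2 : ((Real.sqrt 2 : ℝ) : ℂ) * ((Real.sqrt 2 : ℝ) : ℂ) = 2 := by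
    rw [← Complex.ofReal_mul]; norm_num
  have hc : cnotᴴ * cnot = 1 := by
    ext ⟨a, b⟩ ⟨c, d⟩
    cases a <;> cases b <;> cases c <;> cases d <;>
      simp [Matrix.mul_apply, cnot]
  have hh : hadamardᴴ * hadamard = 1 := by
    ext a b
    cases a <;> cases b <;> simp [Matrix.mul_apply, hadamard] <;> field_simp <;>
      norm_num [pow_two, h2]
  rw [eprGate, Matrix.conjTranspose_mul, Matrix.mul_assoc, ← Matrix.mul_assoc cnotᴴ, hc,
    Matrix.one_mul, Matrix.conjTranspose_kronecker, ← Matrix.mul_kronecker_mul, hh]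
  simp

/-- The EPR pair `(|00⟩ + |11⟩) / √2`. -/
def eprVec (a : Bool × Bool) : ℂ := if a.1 = a.2 then 1 / ((Real.sqrt 2 : ℝ) : ℂ) else 0

/-! ### Decomposable quantum randomized encodings -/

/-- The qubits handled by one part `p` of a decomposable encoding with `m` input qubits: `p = none` is
the offline part, `p = some i` the encoding of the `i`-th input qubit. These are the `i`-th input
qubit if `p = some i`, those halves of EPR pairs that are assigned to `p`, and zero ancillas. -/
abbrev Wire {m pairs : ℕ} (owner : Fin pairs × Bool → Option (Fin m)) (anc : Option (Fin m) → ℕ)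
    (p : Option (Fin m)) : Type :=
  {i : Fin m // some i = p} ⊕ {j : Fin pairs × Bool // owner j = p} ⊕ Fin (anc p)

/-- The encoding operations of a decomposable encoding for `m` input qubits and classical input bits
indexed by `C`, in unitary form. -/
structure Encoder (m : ℕ) (C : Type) where
  /-- The length of the random string `r`. -/
  rndLen : ℕ
  /-- The number of EPR pairs. -/
  pairs : ℕ
  /-- The part of the encoding that acts on a given half of an EPR pair. -/
  owner : Fin pairs × Bool → Option (Fin m)
  /-- The number of zero ancillas of each part. -/
  anc : Option (Fin m) → ℕ
  /-- The unitaries of the offline part and of the input encodings, for every `r`. -/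
  part : Bits rndLen → ∀ p, Matrix (Wire owner anc p → Bool) (Wire owner anc p → Bool) ℂ
  part_unitary : ∀ r p, part r p ∈ Matrix.unitaryGroup (Wire owner anc p → Bool) ℂ
  /-- The qubits which make up the output; all others end up as zero qubits. -/
  kept : ∀ p, Wire owner anc p → Bool
  clean : ∀ r p x y, (∀ a, y (Sum.inr (Sum.inr a)) = false) →
    (∃ w, kept p w = false ∧ x w = true) → part r p x y = 0
  /-- The length of the labels of a classical input bit. -/
  labLen : C → ℕ
  /-- The label of the value `b` of a classical input bit: the classical encoding `F̂ᵢ(b ; r)`. -/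
  lab : Bits rndLen → ∀ i : C, Bool → Bits (labLen i)

namespace Encoder

variable {m : ℕ} {C : Type} (E : Encoder m C)

/-- The computational basis of all qubits of the encoding, except for those that hold labels. -/
abbrev Basis : Type := ∀ p, Wire E.owner E.anc p → Bool

/-- The output qubits, those of the quantum part `F̂₀` of the encoding. -/
abbrev OutWire : Type := {w : Σ p, Wire E.owner E.anc p // E.kept w.1 w.2 = true}

instance : DecidableEq E.OutWire := Subtype.instDecidableEq

/-- The computational basis of the quantum part `F̂₀` of the encoding. -/
abbrev Out : Type := E.OutWire → Bool

/-- Two labels for every classical input bit. -/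
abbrev Labels : Type := ∀ i : C, Bool → Bits (E.labLen i)

/-- One label for every classical input bit. -/
abbrev HalfLabels : Type := ∀ i : C, Bits (E.labLen i)

/-- The registers sorted in another way: input qubits, EPR pairs, ancillas. -/
def sorted : Bits m × (Fin E.pairs → Bool × Bool) × (∀ p, Bits (E.anc p)) ≃ E.Basis where
  toFun s := fun _ w => match w with
    | .inl i => s.1 i.1
    | .inr (.inl j) => if j.1.2 then (s.2.1 j.1.1).2 else (s.2.1 j.1.1).1
    | .inr (.inr a) => s.2.2 _ a
  invFun x :=
    (fun i => x (some i) (.inl ⟨i, rfl⟩),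
      fun k => (x (E.owner (k, false)) (.inr (.inl ⟨(k, false), rfl⟩)),
        x (E.owner (k, true)) (.inr (.inl ⟨(k, true), rfl⟩))),
      fun p a => x p (.inr (.inr a)))
  left_inv s := by simp
  right_inv x := by
    funext p w
    rcases w with ⟨i, rfl⟩ | ⟨⟨k, b⟩, rfl⟩ | a
    · rfl
    · cases b <;> rfl
    · rfl

/-- The basis state with the given output qubits in which all other qubits are zero. -/
def extend (o : E.Out) : E.Basis :=
  fun p w => if h : E.kept p w = true then o ⟨⟨p, w⟩, h⟩ else false

/-- The state `|q⟩ ⊗ |EPR⟩^{⊗ pairs} ⊗ |0⟩`. -/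
def initVec (q : Bits m) : E.Basis → ℂ := fun x =>
  let s := E.sorted.symm x
  if s.1 = q ∧ s.2.2 = (fun _ _ => false) then ∏ k, eprVec (s.2.1 k) else 0

/-- The quantum part `F̂₀` of the encoding with randomness `r`, as a linear map (an isometry) from
input qubits to output qubits: all parts of the encoding are applied to the input, the EPR pairs
and the zero ancillas, and the final zero qubits are dropped. -/
def enc (r : Bits E.rndLen) : Matrix E.Out (Bits m) ℂ :=
  Matrix.of fun o q => (tensor (E.part r)).mulVec (E.initVec q) (E.extend o)

/-- The unitary that creates the EPR pairs from zero qubits and leaves all other qubits alone. -/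
def eprCircuit : Matrix E.Basis E.Basis ℂ :=
  Matrix.reindex E.sorted E.sorted
    ((1 : Matrix (Bits m) (Bits m) ℂ) ⊗ₖ
      (tensor (fun _ : Fin E.pairs => eprGate) ⊗ₖ
        (1 : Matrix (∀ p, Bits (E.anc p)) (∀ p, Bits (E.anc p)) ℂ)))

variable [Fintype C] [DecidableEq C]

/-- The (classical, reversible) circuit that adds all labels to the label qubits. -/
def labelCircuit (r : Bits E.rndLen) : Matrix E.Labels E.Labels ℂ :=
  Matrix.of fun x y => if x = (fun i b t => xor (y i b t) (E.lab r i b t)) then 1 else 0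

/-- The unitary `U_r`: it creates the EPR pairs from zero qubits, applies the encoding operations to
the quantum input, and writes both labels of every classical input bit. -/
def U (r : Bits E.rndLen) : Matrix (E.Basis × E.Labels) (E.Basis × E.Labels) ℂ :=
  (tensor (E.part r) * E.eprCircuit) ⊗ₖ E.labelCircuit r

instance : DecidableEq (E.Basis × E.Labels) := instDecidableEqProd

/-- `U_r` is unitary, so that its conjugate transpose is its inverse. -/
theorem U_conjTranspose_mul_self (r : Bits E.rndLen) : (E.U r)ᴴ * E.U r = 1 := by
  have h1 : (tensor (E.part r))ᴴ * tensor (E.part r) = 1 :=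
    tensor_conjTranspose_mul_self _ fun p => Matrix.mem_unitaryGroup_iff'.1 (E.part_unitary r p)
  have h2 : (E.eprCircuit)ᴴ * E.eprCircuit = 1 := by
    rw [Encoder.eprCircuit, Matrix.conjTranspose_reindex]
    simp only [Matrix.reindex_apply, Matrix.submatrix_mul_equiv, Matrix.conjTranspose_kronecker,
      ← Matrix.mul_kronecker_mul]
    rw [tensor_conjTranspose_mul_self _ (fun _ => eprGate_isometry)]
    simp
  have h3 : (E.labelCircuit r)ᴴ * E.labelCircuit r = 1 := by
    ext x y
    have h : (fun i b t => xor (x i b t) (E.lab r i b t)) =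
        (fun i b t => xor (y i b t) (E.lab r i b t)) ↔ x = y := by
      constructor
      · intro hh
        funext i b t
        simpa using congrFun (congrFun (congrFun hh i) b) t
      · rintro rfl
        rfl
    simp only [Matrix.mul_apply, Encoder.labelCircuit, Matrix.conjTranspose_apply, Matrix.of_apply,
      Matrix.one_apply, apply_ite star, star_one, star_zero, ite_mul, one_mul, zero_mul,
      Finset.sum_ite_eq', Finset.mem_univ, if_true, h]
  rw [Encoder.U, Matrix.conjTranspose_kronecker, ← Matrix.mul_kronecker_mul, h3,
    Matrix.conjTranspose_mul, Matrix.mul_assoc, ← Matrix.mul_assoc (tensor (E.part r))ᴴ, h1,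
    Matrix.one_mul, h2, Matrix.one_kronecker_one]

/-- Append the labels `l` and zero qubits to the output qubits. -/
def append (l : E.Labels) : Matrix (E.Basis × E.Labels) E.Out ℂ :=
  Matrix.of fun y o => if y = (E.extend o, l) then 1 else 0

open Classical in
/-- Append the labels `l` and zero qubits to the state `σ` of the output qubits, apply `U_r⁻¹`, and
measure everything except the input qubits: the probability that only zeros are found.
(For a subnormalized state: the joint probability.) -/
def checkProb (r : Bits E.rndLen) (l : E.Labels) (σ : Matrix E.Out E.Out ℂ) : ℝ :=
  let τ := (E.U r)ᴴ * (E.append l * σ * (E.append l)ᴴ) * E.U r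
  (∑ y : E.Basis × E.Labels,
    if (E.sorted.symm y.1).2 = ((fun _ => (false, false)), (fun _ _ => false)) ∧
      y.2 = (fun _ _ _ => false) then τ y y else 0).re

end Encoder

/-- A decomposable quantum randomized encoding of the functionality `F` with `m` input qubits and
classical input bits indexed by `C`: encoding operations and a decoder, with perfect correctness for
every randomness, also in the presence of side information. Privacy is not part of this
definition. -/
structure DQRE {m : ℕ} {C κ : Type} [Fintype C] [DecidableEq C] [Fintype κ]
    (F : (C → Bool) → QOp (Bits m) κ) extends Encoder m C where
  dec : toEncoder.HalfLabels → QOp toEncoder.Out κ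
  correct : ∀ (r : Bits rndLen) (c : C → Bool) (d : ℕ)
    (ρ : Matrix (Bits m × Fin d) (Bits m × Fin d) ℂ), IsDensity ρ →
    (dec (fun i => lab r i (c i))).applySide
      ((toEncoder.enc r ⊗ₖ (1 : Matrix (Fin d) (Fin d) ℂ)) * ρ *
        (toEncoder.enc r ⊗ₖ (1 : Matrix (Fin d) (Fin d) ℂ))ᴴ) = (F c).applySide ρ

/-! ### Promise problems with a quantum verifier, commitments -/

/-- A function is negligible if it decays faster than any inverse polynomial. -/
def Negligible (μ : ℕ → ℝ) : Prop :=
  Asymptotics.SuperpolynomialDecay Filter.atTop (fun n : ℕ => (n : ℝ)) μ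

structure PromiseProblem where
  yes : ∀ n, Set (Bits n)
  no : ∀ n, Set (Bits n)
  disjoint : ∀ n, Disjoint (yes n) (no n)

/-- A Merlin-Arthur verifier with negligible error for the promise problem `L`: on instances of
length `n` it takes a quantum witness of `witLen n` qubits and outputs one qubit. -/
structure QMAVerifier (L : PromiseProblem) where
  witLen : ℕ → ℕ
  run : ∀ n, Bits n → QOp (Bits (witLen n)) Bool
  err : ℕ → ℝ
  err_negligible : Negligible err
  complete : ∀ n, ∀ x ∈ L.yes n, ∃ ρ, IsDensity ρ ∧ 1 - err n ≤ (run n x).acceptProb ρ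
  sound : ∀ n, ∀ x ∈ L.no n, ∀ ρ, IsDensity ρ → (run n x).acceptProb ρ ≤ err n

/-- The positions of the classical input bits `x, u, v` of the functionality to be encoded. -/
abbrev ClassicalInput (n m : ℕ) : Type := Fin n ⊕ Fin m ⊕ Fin m

/-- The functionality `F` for instance length `n`: on classical input `(x, u, v)` and `m` qubits it
applies `X^{u₁} Z^{v₁} ⊗ ⋯ ⊗ X^{uₘ} Z^{vₘ}` to the qubits and runs the verifier on `x` and the result. -/
def QMAVerifier.padded {L : PromiseProblem} (V : QMAVerifier L) (n : ℕ)
    (z : ClassicalInput n (V.witLen n) → Bool) : QOp (Bits (V.witLen n)) Bool :=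
  (V.run n (fun i => z (.inl i))).precomp
    (pad (fun i => z (.inr (.inl i))) (fun i => z (.inr (.inr i)))) (pad_isometry _ _)

/-- A perfectly binding non-interactive commitment scheme; `com k l msg s` is the commitment to the
`l`-bit message `msg` with randomness `s` for the security parameter `k`. -/
structure CommitmentScheme where
  rndLen : ℕ → ℕ → ℕ
  comLen : ℕ → ℕ → ℕ
  com : ∀ k l : ℕ, Bits l → Bits (rndLen k l) → Bits (comLen k l)
  binding : ∀ (k l : ℕ) (x₁ x₂ : Bits l) (s₁ s₂ : Bits (rndLen k l)),
    com k l x₁ s₁ = com k l x₂ s₂ → x₁ = x₂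

/-! ### The protocol

The messages, the checks of the verifier, and the adaptive provers, for instance length `n`, with
security parameter `n`. -/

section Protocol

variable {L : PromiseProblem} (V : QMAVerifier L) (Com : CommitmentScheme)
  (Q : ∀ n, DQRE (V.padded n)) (n : ℕ)

/-- The commitments in the first message: one to `r`, and one to each label. -/
abbrev Commitments : Type :=
  Bits (Com.comLen n (Q n).rndLen) ×
    (∀ i : ClassicalInput n (V.witLen n), Bool → Bits (Com.comLen n ((Q n).labLen i)))

/-- The basis of the register of the first message `(F̂₀, c₀, (c_{i,b}))`. -/
abbrev FirstMessage : Type := (Q n).Out × Commitments V Com Q n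

/-- The reply to challenge `0`: openings `(r, s₀)` and `(lab_{i,b}, s_{i,b})` of all commitments. -/
abbrev Reply0 : Type :=
  (Bits (Q n).rndLen × Bits (Com.rndLen n (Q n).rndLen)) ×
    ((Q n).Labels × (∀ i : ClassicalInput n (V.witLen n), Bool →
      Bits (Com.rndLen n ((Q n).labLen i))))

/-- The reply to challenge `1`: `z` and the openings `(lab_i, s_i)` for the positions `(i, z_i)`. -/
abbrev Reply1 : Type :=
  (ClassicalInput n (V.witLen n) → Bool) ×
    ((Q n).HalfLabels × (∀ i : ClassicalInput n (V.witLen n),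
      Bits (Com.rndLen n ((Q n).labLen i))))

/-- All openings are valid (challenge `0`). -/
def valid0 (c : Commitments V Com Q n) (a : Reply0 V Com Q n) : Prop :=
  c.1 = Com.com n _ a.1.1 a.1.2 ∧ ∀ i b, c.2 i b = Com.com n _ (a.2.1 i b) (a.2.2 i b)

/-- `z = (x, u, v)` for some `u, v`, and all openings are valid (challenge `1`). -/
def valid1 (x : Bits n) (c : Commitments V Com Q n) (a : Reply1 V Com Q n) : Prop :=
  (∃ u v : Bits (V.witLen n), a.1 = Sum.elim x (Sum.elim u v)) ∧
    ∀ i, c.2 i (a.1 i) = Com.com n _ (a.2.1 i) (a.2.2 i)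

open Classical in
/-- The verifier, on challenge `0`, reads the commitments and the reply `a`, and checks the openings
and the encoding. This is the acceptance probability when `σ` is the (subnormalized) state of the
first message. -/
def accept0 (σ : Matrix (FirstMessage V Com Q n) (FirstMessage V Com Q n) ℂ)
    (a : Reply0 V Com Q n) : ℝ :=
  ∑ c : Commitments V Com Q n, if valid0 V Com Q n c a then
    (Q n).checkProb a.1.1 a.2.1 (readSecond σ c) else 0

open Classical in
/-- The verifier, on challenge `1`, reads the commitments and the reply `a`, checks the openings
against the instance `x`, and decodes. This is the acceptance probability when `σ` is the
(subnormalized) state of the first message. -/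
def accept1 (σ : Matrix (FirstMessage V Com Q n) (FirstMessage V Com Q n) ℂ)
    (x : Bits n) (a : Reply1 V Com Q n) : ℝ :=
  ∑ c : Commitments V Com Q n, if valid1 V Com Q n x c a then
    ((Q n).dec a.2.1).acceptProb (readSecond σ c) else 0

/-- A computationally unbounded adaptive prover: it prepares a joint state of a private register and
the first message; when it has seen the challenge, it performs any measurement on its private
register to produce both its reply and the instance. -/
structure AdaptiveProver where
  dim : ℕ
  state : Matrix (Fin dim × FirstMessage V Com Q n) (Fin dim × FirstMessage V Com Q n) ℂ
  isDensity : IsDensity state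
  reply0 : POVM (Fin dim) (Reply0 V Com Q n × Bits n)
  reply1 : POVM (Fin dim) (Reply1 V Com Q n × Bits n)

variable {V Com Q n}

open Classical in
/-- The probability, given challenge `0`, that the verifier accepts and that the instance is a
no-instance. -/
def AdaptiveProver.winProb0 (P : AdaptiveProver V Com Q n) : ℝ :=
  ∑ a, if a.2 ∈ L.no n then
    accept0 V Com Q n (residual (P.reply0.effect a) P.state) a.1 else 0

open Classical in
/-- The probability, given challenge `1`, that the verifier accepts and that the instance is a
no-instance. -/
def AdaptiveProver.winProb1 (P : AdaptiveProver V Com Q n) : ℝ :=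
  ∑ a, if a.2 ∈ L.no n then
    accept1 V Com Q n (residual (P.reply1.effect a) P.state) a.2 a.1 else 0

/-- The probability, over a uniformly random challenge bit, that the verifier accepts and that the
instance is a no-instance. -/
def AdaptiveProver.winProb (P : AdaptiveProver V Com Q n) : ℝ :=
  1 / 2 * P.winProb0 + 1 / 2 * P.winProb1

end Protocol

end

end QZK

/-! Fix the commitments `c`. By perfect binding they determine at most one string `r` and one table
of labels that can pass challenge 0. Since all parts of the encoding act as unitaries and discard
only zero qubits, `enc r` is an isometry, and undoing `U_r` and finding zeros is exactly the
projection onto its range, or never succeeds when the labels are not those of `r` (`checkProb_eq`).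
So winning challenge 0 has an effect on `F̂₀` at most P = `enc r * (enc r)ᴴ`, whatever the reply and
instance.

If `c` can pass challenge 0, the labels opened on challenge 1 are those of `r` at `z`. On the range
of `enc r` the decoder then computes the verifier of `L` on a padded witness, so each winning effect
there is at most `err n` (`test1_on_encoding`). This is an operator bound, uniform over no-instances
and replies, so it survives tensoring with the prover's measurement of the private register and
summing over outcomes. This is why adaptivity does not help (`two_tests_le`).

A projection P and an effect M with PMP ≤ t²P satisfy P + M ≤ 1 + t + t²
(`posSemidef_sub_projection_add`). Thus the two winning probabilities add up to at most 1 + t + t²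
with t² = |`err n`|. Summing over `c` and halving for the random challenge gives the bound. -/

namespace QZK

open scoped Kronecker Matrix ComplexOrder

noncomputable section

/-! ### Trace inequalities and almost orthogonal tests -/

section LinearAlgebra

variable {α β γ : Type} [Fintype α] [Fintype β] [Fintype γ]

/-- Factoring B = CCᴴ turns the trace into that of CᴴAC, which is positive semidefinite. -/
theorem trace_mul_nonneg {A B : Matrix α α ℂ} (hA : A.PosSemidef) (hB : B.PosSemidef) :
    0 ≤ ((A * B).trace).re := by
  classical
  obtain ⟨C, rfl⟩ : ∃ C : Matrix α α ℂ, B = C * Cᴴ := by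
    open scoped MatrixOrder in
    obtain ⟨C, hC⟩ := CStarAlgebra.nonneg_iff_eq_star_mul_self.1 hB.nonneg
    exact ⟨Cᴴ, by rw [Matrix.conjTranspose_conjTranspose]; exact hC⟩
  rw [← Matrix.mul_assoc, Matrix.trace_mul_comm, ← Matrix.mul_assoc]
  exact (Complex.le_def.1 (hA.conjTranspose_mul_mul_same C).trace_nonneg).1

theorem trace_mul_le {A B ρ : Matrix α α ℂ} (hAB : (B - A).PosSemidef) (hρ : ρ.PosSemidef) :
    ((A * ρ).trace).re ≤ ((B * ρ).trace).re := by
  have := trace_mul_nonneg hAB hρ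
  rw [Matrix.sub_mul, Matrix.trace_sub, Complex.sub_re] at this
  linarith

/-- Passing to the dual picture replaces conditional states by product effects on one fixed joint
state, so that tests after different measurements can be compared as operators. -/
theorem trace_mul_residual (A : Matrix β β ℂ) (E : Matrix α α ℂ)
    (ρ : Matrix (α × β) (α × β) ℂ) :
    (A * residual E ρ).trace = ((E ⊗ₖ A) * ρ).trace := by
  simp only [Matrix.trace, Matrix.diag, Matrix.mul_apply, residual, Matrix.of_apply,
    Matrix.kroneckerMap_apply, Fintype.sum_prod_type, Finset.mul_sum]
  have h : ∀ f : β → β → α → α → ℂ, ∑ b, ∑ b', ∑ i, ∑ j, f b b' i j =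
      ∑ i, ∑ b, ∑ j, ∑ b', f b b' i j := by
    intro f
    calc _ = ∑ b, ∑ i, ∑ j, ∑ b', f b b' i j := by
          refine Finset.sum_congr rfl fun b _ => ?_
          rw [Finset.sum_comm]
          exact Finset.sum_congr rfl fun i _ => Finset.sum_comm
      _ = _ := Finset.sum_comm
  rw [h]
  refine Finset.sum_congr rfl fun i _ => Finset.sum_congr rfl fun b _ =>
    Finset.sum_congr rfl fun j _ => Finset.sum_congr rfl fun b' _ => ?_
  ring

omit [Fintype α] [Fintype β] in
theorem sum_kronecker {ι : Type} (s : Finset ι) (E : ι → Matrix α α ℂ) (A : Matrix β β ℂ) :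
    (∑ i ∈ s, E i) ⊗ₖ A = ∑ i ∈ s, E i ⊗ₖ A := by
  ext
  simp [Matrix.sum_apply, Finset.sum_mul]

omit [Fintype α] [Fintype β] in
theorem kronecker_sub (E : Matrix α α ℂ) (A B : Matrix β β ℂ) :
    E ⊗ₖ (A - B) = E ⊗ₖ A - E ⊗ₖ B := by
  ext
  simp [mul_sub]

/-- If `W` is an isometry whose range is accepted by the effect `M` with probability at most `t²`,
then the projection onto that range and `M` are almost orthogonal. -/
theorem posSemidef_sub_projection_add [DecidableEq α] [DecidableEq γ] {M : Matrix α α ℂ}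
    (W : Matrix α γ ℂ) (hW : Wᴴ * W = 1) (hM : M.PosSemidef) (hM1 : (1 - M).PosSemidef)
    {t : ℝ} (ht : 0 < t) (hWM : (((t ^ 2 : ℝ) : ℂ) • 1 - Wᴴ * M * W).PosSemidef) :
    (((1 + t + t ^ 2 : ℝ) : ℂ) • 1 - (W * Wᴴ + M)).PosSemidef := by
  set P := W * Wᴴ with hP
  have hPH : Pᴴ = P := by simp [hP]
  have hPP : P * P = P := by
    rw [hP, Matrix.mul_assoc, ← Matrix.mul_assoc Wᴴ, hW, Matrix.one_mul]
  have htc : (t : ℂ) ≠ 0 := by exact_mod_cast ht.ne'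
  have hQH : (1 - P)ᴴ = 1 - P := by simp [hPH]
  -- With Q = 1 - P, this is the weighted Cauchy–Schwarz inequality QMP + PMQ ≤ tQMQ + t⁻¹PMP for
  -- the off-diagonal blocks of M. The next two terms bound the diagonal blocks by QMQ ≤ Q and PMP ≤
  -- t²P; the last one, t²Q, fills up the constant on the range of Q.
  have h1 := (hM.conjTranspose_mul_mul_same ((t : ℂ) • (1 - P) - P)).smul
    (a := ((t⁻¹ : ℝ) : ℂ)) (by exact_mod_cast (inv_pos.2 ht).le)
  have h2 := (hM1.conjTranspose_mul_mul_same (1 - P)).smul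
    (a := ((1 + t : ℝ) : ℂ)) (by exact_mod_cast (by positivity : 0 ≤ 1 + t))
  have h3 := (hWM.mul_mul_conjTranspose_same W).smul
    (a := ((1 + t⁻¹ : ℝ) : ℂ)) (by exact_mod_cast (by positivity : 0 ≤ 1 + t⁻¹))
  have h4 := (Matrix.posSemidef_conjTranspose_mul_self (1 - P)).smul
    (a := ((t ^ 2 : ℝ) : ℂ)) (by exact_mod_cast (by positivity : 0 ≤ t ^ 2))
  convert ((h1.add h2).add h3).add h4 using 1
  have e3 : W * (((t ^ 2 : ℝ) : ℂ) • 1 - Wᴴ * M * W) * Wᴴ =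
      ((t ^ 2 : ℝ) : ℂ) • P - P * M * P := by
    simp only [hP, Matrix.mul_sub, Matrix.sub_mul, Matrix.mul_smul, Matrix.smul_mul,
      Matrix.mul_one, Matrix.mul_assoc]
  have e1 : ((t : ℂ) • (1 - P) - P)ᴴ = (t : ℂ) • (1 - P) - P := by
    simp [hPH]
  rw [e1, e3, hQH]
  simp only [Matrix.mul_sub, Matrix.sub_mul, Matrix.mul_smul, Matrix.smul_mul,
    Matrix.mul_one, Matrix.one_mul, hPP, smul_sub, smul_smul, Matrix.mul_assoc]
  generalize P * (M * P) = X1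
  generalize M * P = X2
  generalize P * M = X3
  push_cast
  match_scalars <;> field_simp <;> ring

/-- The weight t⁻¹ in the operator inequality excludes t = 0. That case is needed for a verifier
without error and is reached by letting s decrease to t. -/
theorem trace_projection_add_le [DecidableEq α] [DecidableEq γ] {M ρ : Matrix α α ℂ}
    (W : Matrix α γ ℂ) (hW : Wᴴ * W = 1) (hM : M.PosSemidef) (hM1 : (1 - M).PosSemidef)
    {t : ℝ} (ht : 0 ≤ t) (hWM : (((t ^ 2 : ℝ) : ℂ) • 1 - Wᴴ * M * W).PosSemidef)
    (hρ : ρ.PosSemidef) :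
    (((W * Wᴴ) * ρ).trace).re + ((M * ρ).trace).re ≤ (1 + t + t ^ 2) * (ρ.trace).re := by
  have key : ∀ s, t < s →
      (((W * Wᴴ) * ρ).trace).re + ((M * ρ).trace).re ≤ (1 + s + s ^ 2) * (ρ.trace).re := by
    intro s hs
    have hd : (((s ^ 2 - t ^ 2 : ℝ) : ℂ) • (1 : Matrix γ γ ℂ)).PosSemidef :=
      Matrix.PosSemidef.one.smul (by
        have : 0 ≤ s ^ 2 - t ^ 2 := by nlinarith
        exact_mod_cast this)
    have hWs : (((s ^ 2 : ℝ) : ℂ) • 1 - Wᴴ * M * W).PosSemidef := by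
      convert hWM.add hd using 1
      push_cast
      module
    have := trace_mul_le (posSemidef_sub_projection_add W hW hM hM1 (ht.trans_lt hs) hWs) hρ
    simpa only [Matrix.add_mul, Matrix.trace_add, Complex.add_re, Matrix.smul_mul, Matrix.one_mul,
      Matrix.trace_smul, smul_eq_mul, Complex.re_ofReal_mul] using this
  have hc : Filter.Tendsto (fun s : ℝ => (1 + s + s ^ 2) * (ρ.trace).re)
      (nhdsWithin t (Set.Ioi t)) (nhds ((1 + t + t ^ 2) * (ρ.trace).re)) :=
    (Continuous.tendsto (by fun_prop) t).mono_left nhdsWithin_le_nhds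
  exact ge_of_tendsto hc (Filter.eventually_of_mem self_mem_nhdsWithin key)

variable {O O' : Type} [Fintype O] [Fintype O']

/-- Two measurements of the first part of a joint state, followed by tests of the second part, where
the tests `B` rarely accept on the range of the isometry `W`, and the tests `A` accept at most on
that range. -/
theorem two_tests_le [DecidableEq α] [DecidableEq β] [DecidableEq γ]
    {ρ : Matrix (α × β) (α × β) ℂ} (hρ : ρ.PosSemidef) (M : POVM α O) (N : POVM α O')
    (W : Matrix β γ ℂ) (hW : Wᴴ * W = 1) (A : O → Matrix β β ℂ) (B : O' → Matrix β β ℂ)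
    (hA : ∀ o, (W * Wᴴ - A o).PosSemidef) (hB : ∀ o, (B o).PosSemidef)
    (hB1 : ∀ o, (1 - B o).PosSemidef) {t : ℝ} (ht : 0 ≤ t)
    (hWB : ∀ o, (((t ^ 2 : ℝ) : ℂ) • 1 - Wᴴ * B o * W).PosSemidef) :
    (∑ o, ((A o * residual (M.effect o) ρ).trace).re) +
      ∑ o, ((B o * residual (N.effect o) ρ).trace).re ≤ (1 + t + t ^ 2) * (ρ.trace).re := by
  set W' : Matrix (α × β) (α × γ) ℂ := (1 : Matrix α α ℂ) ⊗ₖ W with hW'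
  have hWW : W'ᴴ * W' = 1 := by
    rw [hW', Matrix.conjTranspose_kronecker, ← Matrix.mul_kronecker_mul, hW]
    simp
  -- The effects of `M` sum to 1, so bounding every `A o` by the same projection removes all
  -- dependence on the outcome.
  have hP : W' * W'ᴴ = ∑ o, M.effect o ⊗ₖ (W * Wᴴ) := by
    rw [hW', Matrix.conjTranspose_kronecker, ← Matrix.mul_kronecker_mul, ← sum_kronecker,
      M.sum_eq_one]
    simp
  set T := ∑ o, N.effect o ⊗ₖ B o with hT
  have hTpos : T.PosSemidef :=
    Matrix.posSemidef_sum _ fun o _ => (N.posSemidef o).kronecker (hB o)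
  have hT1 : (1 - T).PosSemidef := by
    have : 1 - T = ∑ o, N.effect o ⊗ₖ (1 - B o) := by
      simp only [kronecker_sub, Finset.sum_sub_distrib, ← sum_kronecker, N.sum_eq_one, hT]
      simp
    rw [this]
    exact Matrix.posSemidef_sum _ fun o _ => (N.posSemidef o).kronecker (hB1 o)
  -- The bound on the range of `W` holds for each outcome of `N` separately, hence for the combined
  -- effect `T` on the joint system.
  have hWT : (((t ^ 2 : ℝ) : ℂ) • 1 - W'ᴴ * T * W').PosSemidef := by
    have : ((t ^ 2 : ℝ) : ℂ) • 1 - W'ᴴ * T * W' =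
        ∑ o, N.effect o ⊗ₖ (((t ^ 2 : ℝ) : ℂ) • 1 - Wᴴ * B o * W) := by
      simp only [kronecker_sub, Finset.sum_sub_distrib, ← sum_kronecker, N.sum_eq_one, hT,
        Matrix.mul_sum, Matrix.sum_mul, hW', Matrix.conjTranspose_kronecker,
        ← Matrix.mul_kronecker_mul, Matrix.kronecker_smul, ← Finset.smul_sum]
      simp
    rw [this]
    exact Matrix.posSemidef_sum _ fun o _ => (N.posSemidef o).kronecker (hWB o)
  have h := trace_projection_add_le W' hWW hTpos hT1 ht hWT hρ
  refine le_trans (add_le_add ?_ (le_of_eq ?_)) h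
  · rw [hP, Matrix.sum_mul, Matrix.trace_sum, Complex.re_sum]
    refine Finset.sum_le_sum fun o _ => ?_
    rw [trace_mul_residual]
    refine trace_mul_le ?_ hρ
    rw [← kronecker_sub]
    exact (M.posSemidef o).kronecker (hA o)
  · rw [hT, Matrix.sum_mul, Matrix.trace_sum, Complex.re_sum]
    exact Finset.sum_congr rfl fun o _ => by rw [trace_mul_residual]

end LinearAlgebra

/-! ### Acceptance of a quantum operation -/

section Effect

variable {α : Type} [Fintype α] [DecidableEq α]

/-- The effect of outcome `b` when the output qubit of `Φ` is measured. -/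
def QOp.outcomeEffect (Φ : QOp α Bool) (b : Bool) : Matrix α α ℂ :=
  ∑ k, (Φ.kraus k)ᴴ * Matrix.single b b (1 : ℂ) * Φ.kraus k

theorem QOp.outcomeEffect_posSemidef (Φ : QOp α Bool) (b : Bool) :
    (Φ.outcomeEffect b).PosSemidef := by
  refine Matrix.posSemidef_sum _ fun k _ => Matrix.PosSemidef.conjTranspose_mul_mul_same ?_ _
  have : Matrix.single b b (1 : ℂ) = (Matrix.single b b (1 : ℂ))ᴴ * Matrix.single b b 1 := by simp
  rw [this]
  exact Matrix.posSemidef_conjTranspose_mul_self _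

theorem QOp.one_sub_outcomeEffect (Φ : QOp α Bool) :
    1 - Φ.outcomeEffect true = Φ.outcomeEffect false := by
  have h : (1 : Matrix Bool Bool ℂ) = Matrix.single true true 1 + Matrix.single false false 1 := by
    ext a b
    cases a <;> cases b <;> simp
  rw [sub_eq_iff_eq_add', QOp.outcomeEffect, QOp.outcomeEffect, ← Finset.sum_add_distrib,
    ← Φ.complete]
  refine Finset.sum_congr rfl fun k _ => ?_
  rw [← Matrix.add_mul, ← Matrix.mul_add, ← h, Matrix.mul_one]

theorem QOp.acceptProb_eq_trace (Φ : QOp α Bool) (ρ : Matrix α α ℂ) :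
    Φ.acceptProb ρ = ((Φ.outcomeEffect true * ρ).trace).re := by
  have h : ∀ A : Matrix Bool Bool ℂ, A true true = (Matrix.single true true 1 * A).trace := by
    intro A
    simp [Matrix.trace, Matrix.mul_apply, Matrix.single]
  rw [QOp.acceptProb, h (Φ.apply ρ), QOp.apply, QOp.outcomeEffect, Matrix.mul_sum, Matrix.sum_mul]
  simp only [Matrix.trace_sum, Complex.re_sum]
  refine Finset.sum_congr rfl fun k _ => ?_
  rw [← Matrix.mul_assoc, Matrix.trace_mul_comm]
  simp only [Matrix.mul_assoc]

theorem QOp.applySide_kronecker_one {β σ : Type} [Fintype β] [Fintype σ] [DecidableEq σ]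
    (Φ : QOp α β) (ρ : Matrix α α ℂ) :
    Φ.applySide (ρ ⊗ₖ (1 : Matrix σ σ ℂ)) = Φ.apply ρ ⊗ₖ (1 : Matrix σ σ ℂ) := by
  simp only [QOp.applySide, QOp.apply, Matrix.conjTranspose_kronecker, ← Matrix.mul_kronecker_mul,
    sum_kronecker]
  simp

/-- A bound for the acceptance probability of all states is an operator inequality. -/
theorem posSemidef_smul_one_sub {γ : Type} [Fintype γ] [DecidableEq γ] (Φ : QOp α Bool)
    (W : Matrix α γ ℂ) {ε : ℝ}
    (h : ∀ ρ : Matrix γ γ ℂ, IsDensity ρ → Φ.acceptProb (W * ρ * Wᴴ) ≤ ε) :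
    ((ε : ℂ) • 1 - Wᴴ * Φ.outcomeEffect true * W).PosSemidef := by
  have hH : (Wᴴ * Φ.outcomeEffect true * W).IsHermitian :=
    ((Φ.outcomeEffect_posSemidef true).conjTranspose_mul_mul_same W).1
  have hHe : ((ε : ℂ) • 1 - Wᴴ * Φ.outcomeEffect true * W).IsHermitian := by
    refine Matrix.IsHermitian.sub ?_ hH
    simp [Matrix.IsHermitian]
  refine Matrix.PosSemidef.of_dotProduct_mulVec_nonneg hHe fun x => ?_
  have him := hHe.im_star_dotProduct_mulVec_self x
  rw [Complex.le_def]
  refine ⟨?_, him.symm⟩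
  have htr : ∀ A : Matrix γ γ ℂ,
      star x ⬝ᵥ (A *ᵥ x) = (A * Matrix.vecMulVec x (star x)).trace := by
    intro A
    rw [Matrix.mul_vecMulVec, Matrix.trace_vecMulVec, dotProduct_comm]
  have hX : (Matrix.vecMulVec x (star x)).PosSemidef := Matrix.posSemidef_vecMulVec_self_star x
  set X := Matrix.vecMulVec x (star x) with hXdef
  have hX0 := Complex.le_def.1 hX.trace_nonneg
  -- The hypothesis speaks of normalized states, so the rank-one matrix of `x` must be divided by
  -- its trace; trace zero forces it to vanish.
  by_cases h0 : X.trace = 0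
  · rw [hX.trace_eq_zero_iff] at h0
    rw [htr, h0]
    simp
  set p : ℝ := X.trace.re with hp
  have hpX : X.trace = (p : ℂ) := Complex.ext rfl (by simpa using hX0.2.symm)
  have hp0 : 0 < p := lt_of_le_of_ne hX0.1 fun hh => h0 (by rw [hpX, ← hh]; simp)
  have hd : IsDensity (((p⁻¹ : ℝ) : ℂ) • X) := by
    refine ⟨hX.smul (by exact_mod_cast (inv_pos.2 hp0).le), ?_⟩
    rw [Matrix.trace_smul, hpX, smul_eq_mul, ← Complex.ofReal_mul, inv_mul_cancel₀ hp0.ne']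
    simp
  have hb := h _ hd
  have e : (Φ.outcomeEffect true * (W * X * Wᴴ)).trace =
      (Wᴴ * Φ.outcomeEffect true * W * X).trace := by
    rw [← Matrix.mul_assoc, Matrix.trace_mul_comm]
    simp only [Matrix.mul_assoc]
  rw [QOp.acceptProb_eq_trace, Matrix.mul_smul, Matrix.smul_mul, Matrix.mul_smul, Matrix.trace_smul,
    e, smul_eq_mul, Complex.re_ofReal_mul, inv_mul_le_iff₀ hp0] at hb
  rw [htr, Matrix.sub_mul, Matrix.trace_sub, Matrix.smul_mul, Matrix.one_mul, Matrix.trace_smul,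
    smul_eq_mul, Complex.sub_re, Complex.re_ofReal_mul]
  simp only [Complex.zero_re]
  linarith

end Effect

/-! ### The encoding as an isometry -/

theorem eprGate_zero (a : Bool × Bool) : eprGate a (false, false) = eprVec a := by
  obtain ⟨a, b⟩ := a
  cases a <;> cases b <;>
    simp [eprGate, eprVec, Matrix.mul_apply, cnot, hadamard, Fintype.sum_prod_type,
      Matrix.kroneckerMap_apply, Matrix.one_apply]

namespace Encoder

variable {m : ℕ} {C : Type} (E : Encoder m C)

/-- The basis state with the given input qubits in which all other qubits are zero. -/
def blank (q : Bits m) : E.Basis :=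
  E.sorted (q, (fun _ => (false, false)), (fun _ _ => false))

theorem eprCircuit_blank (x : E.Basis) (q : Bits m) :
    E.eprCircuit x (E.blank q) = E.initVec q x := by
  simp only [eprCircuit, blank, initVec, Matrix.reindex_apply, Matrix.submatrix_apply,
    Equiv.symm_apply_apply, Matrix.kroneckerMap_apply, tensor, Matrix.of_apply, eprGate_zero,
    Matrix.one_apply]
  by_cases h1 : (E.sorted.symm x).1 = q <;>
    by_cases h2 : (E.sorted.symm x).2.2 = (fun _ _ => false) <;> simp [h1, h2]

/-- In each summand either `initVec` vanishes because an ancilla of `y` is nonzero, or `clean` kills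
the tensor factor of the part whose discarded qubit is nonzero. -/
theorem tensor_part_mulVec_initVec (r : Bits E.rndLen) (q : Bits m) (x : E.Basis)
    (hx : x ∉ Set.range E.extend) : (tensor (E.part r)).mulVec (E.initVec q) x = 0 := by
  obtain ⟨p, w, hw, hxw⟩ : ∃ p w, E.kept p w = false ∧ x p w = true := by
    by_contra! hcon
    refine hx ⟨fun o => x o.1.1 o.1.2, ?_⟩
    funext p w
    by_cases h : E.kept p w = true
    · simp [extend, h]
    · have := hcon p w (by simpa using h)
      simpa [extend, h] using this.symm
  refine Finset.sum_eq_zero fun y _ => ?_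
  by_cases hy : (E.sorted.symm y).2.2 = (fun _ _ => false)
  · have : tensor (E.part r) x y = 0 := by
      have h0 : E.part r p (x p) (y p) = 0 :=
        E.clean r p _ _ (fun a => congrFun (congrFun hy p) a) ⟨w, hw, hxw⟩
      exact Finset.prod_eq_zero (f := fun p => E.part r p (x p) (y p)) (Finset.mem_univ p) h0
    simp [this]
  · simp [initVec, hy]

theorem extend_injective : Function.Injective E.extend := by
  intro o o' h
  funext ⟨⟨p, w⟩, hw⟩
  simpa [extend, hw] using congrFun (congrFun h p) w

variable [Fintype C] [DecidableEq C]

/-- Append zero qubits to the input qubits. -/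
def inputIsometry : Matrix (E.Basis × E.Labels) (Bits m) ℂ :=
  Matrix.of fun y q => if y = (E.blank q, fun _ _ _ => false) then 1 else 0

theorem inputIsometry_conjTranspose_mul_self : E.inputIsometryᴴ * E.inputIsometry = 1 := by
  ext q q'
  have h : E.blank q = E.blank q' ↔ q = q' := by simp [blank]
  simp only [Matrix.mul_apply, inputIsometry, Matrix.conjTranspose_apply, Matrix.of_apply,
    Matrix.one_apply, apply_ite star, star_one, star_zero, ite_mul, one_mul, zero_mul,
    Finset.sum_ite_eq', Finset.mem_univ, if_true, Prod.mk.injEq, and_true, h]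

theorem append_conjTranspose_mul_append (l l' : E.Labels) :
    (E.append l)ᴴ * E.append l' = if l = l' then 1 else 0 := by
  ext o o'
  have h : E.extend o = E.extend o' ↔ o = o' := E.extend_injective.eq_iff
  simp only [Matrix.mul_apply, append, Matrix.conjTranspose_apply, Matrix.of_apply,
    apply_ite star, star_one, star_zero, ite_mul, one_mul, zero_mul,
    Finset.sum_ite_eq', Finset.mem_univ, if_true, Prod.mk.injEq, h]
  by_cases hl : l = l' <;> simp [hl, Matrix.one_apply]

/-- This links the circuit `U_r` to the encoding map: run on blank registers, it yields the encoded
state next to the correct labels, and nothing is lost by dropping the discarded qubits. -/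
theorem U_mul_inputIsometry (r : Bits E.rndLen) :
    E.U r * E.inputIsometry = E.append (E.lab r) * E.enc r := by
  ext ⟨x, l⟩ q
  have hl : (E.U r * E.inputIsometry) (x, l) q =
      (tensor (E.part r)).mulVec (E.initVec q) x * if l = E.lab r then 1 else 0 := by
    simp only [Matrix.mul_apply, inputIsometry, Matrix.of_apply, mul_ite, mul_one, mul_zero,
      Finset.sum_ite_eq', Finset.mem_univ, if_true, U,
      Matrix.kroneckerMap_apply, eprCircuit_blank, labelCircuit, Bool.false_xor]
    rfl
  rw [hl]
  simp only [Matrix.mul_apply, append, Matrix.of_apply, ite_mul, one_mul, zero_mul,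
    Prod.mk.injEq]
  by_cases hx : x ∈ Set.range E.extend
  · obtain ⟨o, rfl⟩ := hx
    by_cases h : l = E.lab r <;> simp [h, E.extend_injective.eq_iff, enc]
  · rw [E.tensor_part_mulVec_initVec r q x hx, zero_mul]
    refine (Finset.sum_eq_zero fun o _ => if_neg ?_).symm
    rintro ⟨rfl, -⟩
    exact hx ⟨o, rfl⟩

/-- Appending fixed labels and zeros is isometric, so the claim is inherited from the unitary `U_r`.
-/
theorem enc_conjTranspose_mul_self (r : Bits E.rndLen) : (E.enc r)ᴴ * E.enc r = 1 := by
  have h1 : (E.append (E.lab r))ᴴ * E.append (E.lab r) = 1 := by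
    simp [append_conjTranspose_mul_append]
  calc (E.enc r)ᴴ * E.enc r
      = (E.enc r)ᴴ * ((E.append (E.lab r))ᴴ * E.append (E.lab r)) * E.enc r := by
        rw [h1, Matrix.mul_one]
    _ = (E.append (E.lab r) * E.enc r)ᴴ * (E.append (E.lab r) * E.enc r) := by
        simp only [Matrix.conjTranspose_mul, Matrix.mul_assoc]
    _ = E.inputIsometryᴴ * ((E.U r)ᴴ * E.U r) * E.inputIsometry := by
        rw [← U_mul_inputIsometry]
        simp only [Matrix.conjTranspose_mul, Matrix.mul_assoc]
    _ = 1 := by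
        rw [U_conjTranspose_mul_self, Matrix.mul_one, inputIsometry_conjTranspose_mul_self]

theorem checkProb_eq_trace_inputIsometry (r : Bits E.rndLen) (l : E.Labels)
    (σ : Matrix E.Out E.Out ℂ) :
    E.checkProb r l σ = ((E.inputIsometryᴴ * ((E.U r)ᴴ *
      (E.append l * σ * (E.append l)ᴴ) * E.U r) * E.inputIsometry).trace).re := by
  classical
  rw [checkProb]
  generalize (E.U r)ᴴ * (E.append l * σ * (E.append l)ᴴ) * E.U r = τ
  congr 1
  have h : ∀ q, (E.inputIsometryᴴ * τ * E.inputIsometry) q q =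
      τ (E.blank q, fun _ _ _ => false) (E.blank q, fun _ _ _ => false) := by
    intro q
    simp only [Matrix.mul_apply, inputIsometry, Matrix.conjTranspose_apply, Matrix.of_apply,
      apply_ite star, star_one, star_zero, ite_mul, one_mul, zero_mul, mul_ite, mul_one, mul_zero,
      Finset.sum_ite_eq', Finset.mem_univ, if_true]
  simp only [Matrix.trace, Matrix.diag, h]
  rw [← Finset.sum_filter]
  symm
  -- The basis states that pass the zero check are exactly the blank ones, one for each value of the
  -- input qubits.
  refine Finset.sum_bij (fun q _ => (E.blank q, fun _ _ _ => false)) ?_ ?_ ?_ ?_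
  · intro q _
    simp [blank]
  · intro q _ q' _ hq
    simpa [blank] using hq
  · rintro ⟨x, l'⟩ hx
    simp only [Finset.mem_filter, Finset.mem_univ, true_and] at hx
    refine ⟨(E.sorted.symm x).1, Finset.mem_univ _, ?_⟩
    rw [hx.2, blank, ← hx.1, Prod.mk.eta, Equiv.apply_symm_apply]
  · intro q _
    rfl

/-- The check passes if the labels are correct and the output qubits are in the range of the
encoding. -/
theorem checkProb_eq (r : Bits E.rndLen) (l : E.Labels) (σ : Matrix E.Out E.Out ℂ) :
    E.checkProb r l σ =
      (((if l = E.lab r then E.enc r * (E.enc r)ᴴ else 0) * σ).trace).re := by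
  -- Labels are orthogonal basis states, so wrong labels have zero overlap with any output of `U_r`
  -- on blank registers.
  have h : (E.append l)ᴴ * E.U r * E.inputIsometry = if l = E.lab r then E.enc r else 0 := by
    rw [Matrix.mul_assoc, U_mul_inputIsometry, ← Matrix.mul_assoc, append_conjTranspose_mul_append]
    split_ifs <;> simp
  have h2 : E.inputIsometryᴴ * ((E.U r)ᴴ * (E.append l * σ * (E.append l)ᴴ) * E.U r) *
      E.inputIsometry = ((E.append l)ᴴ * E.U r * E.inputIsometry)ᴴ * σ *
        ((E.append l)ᴴ * E.U r * E.inputIsometry) := by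
    simp only [Matrix.conjTranspose_mul, Matrix.conjTranspose_conjTranspose, Matrix.mul_assoc]
  rw [checkProb_eq_trace_inputIsometry, h2, h]
  split_ifs
  · rw [Matrix.trace_mul_comm, ← Matrix.mul_assoc]
  · simp

end Encoder

/-! ### Soundness of the decoder and of the protocol -/

theorem IsDensity.mul_mul_conjTranspose {α β : Type} [Fintype α] [Fintype β] [DecidableEq α]
    {ρ : Matrix α α ℂ} (hρ : IsDensity ρ) (W : Matrix β α ℂ) (hW : Wᴴ * W = 1) :
    IsDensity (W * ρ * Wᴴ) :=
  ⟨hρ.posSemidef.mul_mul_conjTranspose_same W, by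
    rw [Matrix.trace_mul_comm, ← Matrix.mul_assoc, hW, Matrix.one_mul, hρ.trace_eq_one]⟩

/-- Perfect correctness is applied with a one-dimensional side register. -/
theorem DQRE.acceptProb_dec {m : ℕ} {C : Type} [Fintype C] [DecidableEq C]
    {F : (C → Bool) → QOp (Bits m) Bool} (E : DQRE F) (r : Bits E.rndLen) (z : C → Bool)
    {ρ : Matrix (Bits m) (Bits m) ℂ} (hρ : IsDensity ρ) :
    (E.dec (fun i => E.lab r i (z i))).acceptProb (E.enc r * ρ * (E.enc r)ᴴ) =
      (F z).acceptProb ρ := by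
  have hd : IsDensity (ρ ⊗ₖ (1 : Matrix (Fin 1) (Fin 1) ℂ)) :=
    ⟨hρ.posSemidef.kronecker Matrix.PosSemidef.one, by
      rw [Matrix.trace_kronecker, hρ.trace_eq_one]
      simp⟩
  have h := E.correct r z 1 _ hd
  rw [Matrix.conjTranspose_kronecker, ← Matrix.mul_kronecker_mul, ← Matrix.mul_kronecker_mul,
    Matrix.conjTranspose_one, Matrix.mul_one, Matrix.mul_one, QOp.applySide_kronecker_one,
    QOp.applySide_kronecker_one] at h
  have h0 := congrFun (congrFun h (true, 0)) (true, 0)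
  simp only [Matrix.kroneckerMap_apply, Matrix.one_apply_eq, mul_one] at h0
  rw [QOp.acceptProb, h0, QOp.acceptProb]

/-- Undoing the one-time pad only turns one candidate witness into another, and soundness covers all
of them. -/
theorem QMAVerifier.acceptProb_padded_le {L : PromiseProblem} (V : QMAVerifier L) (n : ℕ)
    {x : Bits n} (hx : x ∈ L.no n) (u v : Bits (V.witLen n))
    {ρ : Matrix (Bits (V.witLen n)) (Bits (V.witLen n)) ℂ} (hρ : IsDensity ρ) :
    (V.padded n (Sum.elim x (Sum.elim u v))).acceptProb ρ ≤ V.err n := by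
  have h : (V.padded n (Sum.elim x (Sum.elim u v))).acceptProb ρ =
      (V.run n x).acceptProb (pad u v * ρ * (pad u v)ᴴ) := by
    simp only [QOp.acceptProb, QOp.apply, QMAVerifier.padded, QOp.precomp,
      Matrix.conjTranspose_mul, Matrix.mul_assoc, Sum.elim_inl, Sum.elim_inr]
    rfl
  rw [h]
  exact V.sound n x hx _ (hρ.mul_mul_conjTranspose _ (pad_isometry u v))

/-- The decay of f against n²ᵏ gives that of its root against nᵏ. -/
theorem Negligible.sqrt_abs {f : ℕ → ℝ} (hf : Negligible f) :
    Negligible fun n => Real.sqrt |f n| := by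
  intro k
  have h := ((Asymptotics.superpolynomialDecay_iff_superpolynomialDecay_abs _ _ _).1 hf) (2 * k)
  have h2 := (Real.continuous_sqrt.tendsto 0).comp h
  rw [Real.sqrt_zero] at h2
  refine h2.congr fun n => ?_
  simp only [Function.comp_apply, Nat.abs_cast]
  rw [Real.sqrt_mul (by positivity), mul_comm 2 k, pow_mul, Real.sqrt_sq (by positivity)]

theorem Negligible.abs {f : ℕ → ℝ} (hf : Negligible f) : Negligible fun n => |f n| := by
  intro k
  have h := ((Asymptotics.superpolynomialDecay_iff_superpolynomialDecay_abs _ _ _).1 hf) k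
  simpa using h

/-! ### Binding, and the two challenges for fixed commitments -/

section Protocol

variable {L : PromiseProblem} {V : QMAVerifier L} {Com : CommitmentScheme}
  {Q : ∀ n, DQRE (V.padded n)} {n : ℕ}

theorem valid0.unique {c : Commitments V Com Q n} {a a' : Reply0 V Com Q n}
    (h : valid0 V Com Q n c a) (h' : valid0 V Com Q n c a') :
    a.1.1 = a'.1.1 ∧ a.2.1 = a'.2.1 := by
  refine ⟨Com.binding _ _ _ _ _ _ (h.1.symm.trans h'.1), ?_⟩
  funext i b
  exact Com.binding _ _ _ _ _ _ ((h.2 i b).symm.trans (h'.2 i b))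

/-- The opening for challenge 0 need not be sent by the prover; its mere existence pins down every
label that can be opened on challenge 1. -/
theorem valid1.label_eq {c : Commitments V Com Q n} {a : Reply0 V Com Q n} {x : Bits n}
    {a' : Reply1 V Com Q n} (h : valid0 V Com Q n c a) (h' : valid1 V Com Q n x c a') :
    a'.2.1 = fun i => a.2.1 i (a'.1 i) := by
  funext i
  exact Com.binding _ _ _ _ _ _ ((h'.2 i).symm.trans (h.2 i _))

namespace AdaptiveProver

variable (P : AdaptiveProver V Com Q n)

/-- The subnormalized state of the private register and `F̂₀` when the commitments are `c`. -/
def stateGiven (c : Commitments V Com Q n) :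
    Matrix (Fin P.dim × (Q n).Out) (Fin P.dim × (Q n).Out) ℂ :=
  P.state.submatrix (fun y => (y.1, (y.2, c))) (fun y => (y.1, (y.2, c)))

theorem sum_trace_stateGiven : ∑ c, ((P.stateGiven c).trace).re = 1 := by
  have h := congrArg Complex.re P.isDensity.trace_eq_one
  rw [Complex.one_re] at h
  rw [← h, ← Complex.re_sum]
  congr 1
  simp only [Matrix.trace, Matrix.diag, stateGiven, Matrix.submatrix_apply]
  rw [← Fintype.sum_prod_type']
  exact Fintype.sum_equiv ⟨fun y => (y.2.1, (y.2.2, y.1)), fun y => (y.2.2, (y.1, y.2.1)),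
    fun _ => rfl, fun _ => rfl⟩ _ _ fun _ => rfl

open Classical in
/-- The effect on `F̂₀` of the test on challenge `0`. -/
def test0 (c : Commitments V Com Q n) (a : Reply0 V Com Q n × Bits n) :
    Matrix (Q n).Out (Q n).Out ℂ :=
  if a.2 ∈ L.no n ∧ valid0 V Com Q n c a.1 ∧ a.1.2.1 = (Q n).lab a.1.1.1 then
    (Q n).enc a.1.1.1 * ((Q n).enc a.1.1.1)ᴴ else 0

open Classical in
/-- The effect on `F̂₀` of the test on challenge `1`. -/
def test1 (c : Commitments V Com Q n) (a : Reply1 V Com Q n × Bits n) :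
    Matrix (Q n).Out (Q n).Out ℂ :=
  if a.2 ∈ L.no n ∧ valid1 V Com Q n a.2 c a.1 then
    ((Q n).dec a.1.2.1).outcomeEffect true else 0

theorem winProb0_eq : P.winProb0 = ∑ c, ∑ a,
    ((test0 c a * residual (P.reply0.effect a) (P.stateGiven c)).trace).re := by
  rw [Finset.sum_comm, winProb0]
  refine Finset.sum_congr rfl fun a _ => ?_
  -- Reading the commitments commutes with measuring the private register, so one may condition on
  -- `c` before the reply is produced.
  have hr : ∀ c, readSecond (residual (P.reply0.effect a) P.state) c =
      residual (P.reply0.effect a) (P.stateGiven c) := fun _ => rfl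
  by_cases hx : a.2 ∈ L.no n
  · rw [if_pos hx, accept0]
    refine Finset.sum_congr rfl fun c _ => ?_
    rw [hr, Encoder.checkProb_eq]
    by_cases hv : valid0 V Com Q n c a.1 <;> simp [test0, hx, hv]
  · simp [test0, hx]

theorem winProb1_eq : P.winProb1 = ∑ c, ∑ a,
    ((test1 c a * residual (P.reply1.effect a) (P.stateGiven c)).trace).re := by
  rw [Finset.sum_comm, winProb1]
  refine Finset.sum_congr rfl fun a _ => ?_
  have hr : ∀ c, readSecond (residual (P.reply1.effect a) P.state) c =
      residual (P.reply1.effect a) (P.stateGiven c) := fun _ => rfl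
  by_cases hx : a.2 ∈ L.no n
  · rw [if_pos hx, accept1]
    refine Finset.sum_congr rfl fun c _ => ?_
    rw [hr, QOp.acceptProb_eq_trace]
    by_cases hv : valid1 V Com Q n a.2 c a.1 <;> simp [test1, hx, hv]
  · simp [test1, hx]

theorem test1_posSemidef (c : Commitments V Com Q n) (a : Reply1 V Com Q n × Bits n) :
    (test1 c a).PosSemidef := by
  rw [test1]
  split_ifs
  · exact QOp.outcomeEffect_posSemidef _ _
  · exact Matrix.PosSemidef.zero

theorem one_sub_test1_posSemidef (c : Commitments V Com Q n) (a : Reply1 V Com Q n × Bits n) :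
    (1 - test1 c a).PosSemidef := by
  rw [test1]
  split_ifs
  · rw [QOp.one_sub_outcomeEffect]
    exact QOp.outcomeEffect_posSemidef _ _
  · rw [sub_zero]
    exact Matrix.PosSemidef.one

/-- If the committed labels are those of the committed randomness, the test on challenge `1` rarely
accepts honest encodings. -/
theorem test1_on_encoding {c : Commitments V Com Q n} {a : Reply0 V Com Q n}
    (h : valid0 V Com Q n c a) (hl : a.2.1 = (Q n).lab a.1.1) {ε : ℝ} (hε0 : 0 ≤ ε)
    (hε : V.err n ≤ ε) (a' : Reply1 V Com Q n × Bits n) :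
    ((ε : ℂ) • 1 - ((Q n).enc a.1.1)ᴴ * test1 c a' * (Q n).enc a.1.1).PosSemidef := by
  rw [test1]
  split_ifs with hv
  · refine posSemidef_smul_one_sub _ _ fun ρ hρ => ?_
    obtain ⟨⟨u, v, hz⟩, -⟩ := hv.2
    rw [valid1.label_eq h hv.2, hl, DQRE.acceptProb_dec _ _ _ hρ, hz]
    exact (V.acceptProb_padded_le n hv.1 u v hρ).trans hε
  · rw [Matrix.mul_zero, Matrix.zero_mul, sub_zero]
    exact Matrix.PosSemidef.one.smul (by exact_mod_cast hε0)

theorem tests_le (c : Commitments V Com Q n) {t : ℝ} (ht : 0 ≤ t) (hε : V.err n ≤ t ^ 2) :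
    (∑ a, ((test0 c a * residual (P.reply0.effect a) (P.stateGiven c)).trace).re) +
      ∑ a, ((test1 c a * residual (P.reply1.effect a) (P.stateGiven c)).trace).re ≤
      (1 + t + t ^ 2) * ((P.stateGiven c).trace).re := by
  have hρ : (P.stateGiven c).PosSemidef := P.isDensity.posSemidef.submatrix _
  -- Either `c` hides a consistent pair of randomness and labels, which yields the subspace, or
  -- challenge 0 cannot be won.
  by_cases h : ∃ a, valid0 V Com Q n c a ∧ a.2.1 = (Q n).lab a.1.1
  · obtain ⟨a, ha, hl⟩ := h
    refine two_tests_le hρ P.reply0 P.reply1 ((Q n).enc a.1.1)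
      (Encoder.enc_conjTranspose_mul_self _ _) _ _ (fun o => ?_) (test1_posSemidef c)
      (one_sub_test1_posSemidef c) ht (test1_on_encoding ha hl (sq_nonneg t) hε)
    rw [test0]
    split_ifs with ho
    -- Binding identifies the randomness in the reply with that of `a`, so the test is the
    -- projection itself.
    · rw [(ha.unique ho.2.1).1, sub_self]
      exact Matrix.PosSemidef.zero
    · rw [sub_zero]
      exact Matrix.posSemidef_self_mul_conjTranspose _
  -- With challenge 0 lost, the zero subspace serves: the isometry from the empty register makes the
  -- projection zero and the condition on challenge 1 vacuous.
  · refine two_tests_le hρ P.reply0 P.reply1 (0 : Matrix (Q n).Out Empty ℂ)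
      (Subsingleton.elim _ _) _ _ (fun o => ?_) (test1_posSemidef c)
      (one_sub_test1_posSemidef c) ht (fun o => ?_)
    · rw [test0, if_neg fun ho => h ⟨_, ho.2⟩]
      simpa using Matrix.PosSemidef.zero
    · rw [Subsingleton.elim (_ - _) 0]
      exact Matrix.PosSemidef.zero

theorem winProb_le {t : ℝ} (ht : 0 ≤ t) (hε : V.err n ≤ t ^ 2) :
    P.winProb ≤ 1 / 2 + 1 / 2 * (t + t ^ 2) := by
  have h := Finset.sum_le_sum fun c (_ : c ∈ Finset.univ) => P.tests_le c ht hε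
  rw [Finset.sum_add_distrib, ← winProb0_eq, ← winProb1_eq, ← Finset.mul_sum,
    sum_trace_stateGiven] at h
  rw [winProb]
  linarith

end AdaptiveProver

end Protocol

end

end QZK

/-- Statistical adaptive soundness with error `1/2 + negl`. -/
theorem lemma5p2 (L : QZK.PromiseProblem) (V : QZK.QMAVerifier L) (Com : QZK.CommitmentScheme)
    (Q : ∀ n, QZK.DQRE (V.padded n)) :
    ∃ μ' : ℕ → ℝ, QZK.Negligible μ' ∧
      ∀ (n : ℕ) (P : QZK.AdaptiveProver V Com Q n), P.winProb ≤ 1 / 2 + μ' n := by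
  -- This is (t + t²)/2 at t = √|`err n`|. The absolute value is needed because `err n` is not
  -- assumed nonnegative.
  refine ⟨fun n => 1 / 2 * (√|V.err n| + |V.err n|), ?_, fun n P => ?_⟩
  · exact (V.err_negligible.sqrt_abs.add V.err_negligible.abs).const_mul (1 / 2)
  · have hs : √|V.err n| ^ 2 = |V.err n| := Real.sq_sqrt (abs_nonneg _)
    have h := P.winProb_le (Real.sqrt_nonneg |V.err n|) ((le_abs_self _).trans_eq hs.symm)
    rwa [hs] at h
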